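/- Let $A$ be a finite alphabet with $|A| \geq 2$, and let $A^*$ be the free monoid of words over $A$. A monoid $M$ recognises a language $L \subseteq A^*$ if $L = \eta^{-1}(S)$ for some monoid morphism $\eta\colon A^* \to M$ and some $S \subseteq M$. For $n \geq 1$ let $\mathsf{Gnil}_A^{\leq n}$ (resp. $\mathsf{Gsol}_A^{\leq n}$) be the set of languages $L \subseteq A^*$ recognised by a finite nilpotent group of class at most $n$ (resp. by a finite solvable group of derived length at most $n$). Then for every $n \geq 1$ $$\mathsf{Gnil}_A^{\leq n} \subsetneq \mathsf{Gnil}_A^{\leq n+1} \quad\text{and}\quad \mathsf{Gsol}_A^{\leq n} \subsetneq \mathsf{Gsol}_A^{\leq n+1}.$$ Moreover, word problems of two-generated finite groups witness strictness. The dihedral group $G$ of order $2^{n+2}$ is two-generated and nilpotent of class exactly $n+1$, and there is a surjective morphism $\eta\colon A^* \to G$ with $\eta^{-1}(1_G) \in \mathsf{Gnil}_A^{\leq n+1} \setminus \mathsf{Gnil}_A^{\leq n}$. Likewise there are a two-generated finite solvable group $G$ of derived length exactly $n+1$ and a surjective morphism $\eta\colon A^* \to G$ with $\eta^{-1}(1_G)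 \in \mathsf{Gsol}_A^{\leq n+1} \setminus \mathsf{Gsol}_A^{\leq n}$. -/

import Mathlib

/-- The monoid `M` recognises the language `L ⊆ A*`: there are a monoid morphism `η : A* → M` and a
subset `S` of `M` with `L = η⁻¹(S)`. -/
def Recognises (M : Type*) [Monoid M] {A : Type*} (L : Language A) : Prop :=
  ∃ (η : FreeMonoid A →* M) (S : Set M), ∀ w : List A, w ∈ L ↔ η (FreeMonoid.ofList w) ∈ S

/-- The derived length of a group: the least `k` such that the `k`-th term of the derived series
is trivial. It is used for solvable groups only. -/
noncomputable def derivedLength (G : Type*) [Group G] : ℕ :=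
  sInf {k : ℕ | derivedSeries G k = ⊥}

/-- The languages over `A` recognised by a finite nilpotent group of class at most `n`.
Every finite group is isomorphic to one in `Type`, so the universe is no restriction. -/
def Gnil (A : Type*) (n : ℕ) : Set (Language A) :=
  {L | ∃ (G : Type) (_ : Group G), Finite G ∧ Group.IsNilpotent G ∧
    Group.nilpotencyClass G ≤ n ∧ Recognises G L}

/-- The languages over `A` recognised by a finite solvable group of derived length at most `n`. -/
def Gsol (A : Type*) (n : ℕ) : Set (Language A) :=
  {L | ∃ (G : Type) (_ : Group G), Finite G ∧ Group.IsSolvable G ∧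
    derivedLength G ≤ n ∧ Recognises G L}

/-- The group `G` is generated by two (not necessarily distinct) elements. -/
def IsTwoGenerated (G : Type*) [Group G] : Prop :=
  ∃ x y : G, Subgroup.closure {x, y} = ⊤

/-- The word problem `η⁻¹(1) ⊆ A*` of a group `G` with respect to a morphism `η : A* → G`. -/
def wordProblem {A G : Type*} [Group G] (η : FreeMonoid A →* G) : Language A :=
  {w : List A | η (FreeMonoid.ofList w) = 1}

/-! A morphism `η` from `A*` onto a finite group `G` has the property that any finite group `H`
recognising `η⁻¹(1)` has `G` as a quotient of one of its subgroups: if `θ : A* → H` is a recognising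
morphism, `θ u = θ v` forces `η u = η v`, and submonoids of finite groups are subgroups. Nilpotency
class and derived length do not increase under subgroups and quotients, so the word problem of `G`
lies at exactly the level of `G` in the hierarchy
(`nilpotencyClass_le_of_wordProblem_mem_Gnil`, `derivedLength_le_of_wordProblem_mem_Gsol`).
It remains to find two-generated groups of each nilpotency class and each derived length.

In the dihedral group of order `2 ^ (n + 2)`, the `k`-th term of the lower central series (`k ≥ 1`)
is generated by the rotation `r (2 ^ k)`, which gives the class `n + 1`.

For derived length, let the free group `F` of rank two act through the matrices `[1, 2; 0, 1]` and
`[1, 0; 2, 1]`. Its image modulo `2 ^ (k + 1)` is solvable of derived length at most `k`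
(`derivedSeries_le_ker_toSL2Mod`), because a commutator of two matrices that are trivial modulo
`2 ^ i`, `i ≥ 1`, is trivial modulo `2 ^ (i + 1)`. These derived lengths are unbounded: the image
modulo `5` is perfect, so every term of the derived series of `F` has an element with nontrivial
image in `SL(2, ℤ)`, and it stays nontrivial modulo a large power of `2`. The quotient of such an
image by the term `n + 1` of its derived series has derived length exactly `n + 1`. -/

/-! ### Recognition of a word problem -/

/-- The subgroup of `H × G` formed by the pairs `(θ w, η w)` maps injectively to `H`, because
`η⁻¹(1)` is saturated for `θ`, and onto `G`. -/
theorem exists_subgroup_surjective_of_recognises {A G H : Type*} [Group G] [Finite G] [Group H]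
    [Finite H] {η : FreeMonoid A →* G} (hη : Function.Surjective η)
    (h : Recognises H (wordProblem η)) :
    ∃ (K : Subgroup H) (g : K →* G), Function.Surjective g := by
  obtain ⟨θ, S, hS⟩ := h
  have hmem (w : FreeMonoid A) : η w = 1 ↔ θ w ∈ S := hS w.toList
  have key (u v : FreeMonoid A) (huv : θ u = θ v) : η u = η v := by
    obtain ⟨x, hx⟩ := hη (η u)⁻¹
    have hu : η (x * u) = 1 := by simp [hx]
    rw [hmem, map_mul, huv, ← map_mul, ← hmem, map_mul, hx] at hu
    exact (inv_mul_eq_one.mp hu)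
  let P : Subgroup (H × G) := Subgroup.closure (MonoidHom.mrange (θ.prod η))
  have hP (p : H × G) : p ∈ P ↔ ∃ w, (θ w, η w) = p := by
    rw [← Subgroup.mem_toSubmonoid, Subgroup.closure_toSubmonoid_of_finite, Submonoid.closure_eq]
    rfl
  let f : P →* H := (MonoidHom.fst H G).comp P.subtype
  have hf : Function.Injective f := by
    rw [injective_iff_map_eq_one]
    rintro ⟨p, hp⟩ h1
    obtain ⟨w, rfl⟩ := (hP p).mp hp
    have h1 : θ w = 1 := h1
    have h2 : η w = 1 := by simpa using key w 1 (by simpa using h1)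
    exact Subtype.ext (Prod.ext h1 h2)
  refine ⟨f.range, ((MonoidHom.snd H G).comp P.subtype).comp
    (MonoidHom.ofInjective hf).symm.toMonoidHom, ?_⟩
  intro x
  obtain ⟨w, rfl⟩ := hη x
  refine ⟨MonoidHom.ofInjective hf ⟨(θ w, η w), (hP _).mpr ⟨w, rfl⟩⟩, ?_⟩
  simp

theorem wordProblem_recognises {A G : Type*} [Group G] (η : FreeMonoid A →* G) :
    Recognises G (wordProblem η) :=
  ⟨η, {1}, fun _ => Iff.rfl⟩

theorem nilpotencyClass_le_of_wordProblem_mem_Gnil {A G : Type*} [Group G] [Finite G]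
    {η : FreeMonoid A →* G} (hη : Function.Surjective η) {n : ℕ} (h : wordProblem η ∈ Gnil A n) :
    Group.nilpotencyClass G ≤ n := by
  obtain ⟨H, _, _, _, hn, hr⟩ := h
  obtain ⟨K, g, hg⟩ := exists_subgroup_surjective_of_recognises hη hr
  exact (Group.nilpotencyClass_le_of_surjective g hg).trans 
    ((Subgroup.nilpotencyClass_le K).trans hn)

/-- For groups that are not solvable `derivedLength` takes the junk value `0`, hence the hypothesis. -/
theorem derivedLength_le_iff {G : Type*} [Group G] [hG : Group.IsSolvable G] {n : ℕ} :
    derivedLength G ≤ n ↔ derivedSeries G n = ⊥ := by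
  refine ⟨fun h => ?_, fun h => Nat.sInf_le h⟩
  have : derivedSeries G (derivedLength G) = ⊥ := Nat.sInf_mem hG.solvable
  exact le_bot_iff.mp ((derivedSeries_antitone G h).trans this.le)

theorem derivedLength_le_of_wordProblem_mem_Gsol {A G : Type*} [Group G] [Finite G]
    [Group.IsSolvable G]
    {η : FreeMonoid A →* G} (hη : Function.Surjective η) {n : ℕ} (h : wordProblem η ∈ Gsol A n) :
    derivedLength G ≤ n := by
  obtain ⟨H, _, _, _, hn, hr⟩ := h
  obtain ⟨K, g, hg⟩ := exists_subgroup_surjective_of_recognises hη hr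
  rw [derivedLength_le_iff] at hn ⊢
  have hK : derivedSeries K n = ⊥ := by
    rw [← Subgroup.map_eq_bot_iff_of_injective _ K.subtype_injective, eq_bot_iff, ← hn]
    exact map_derivedSeries_le_derivedSeries K.subtype n
  rw [← map_derivedSeries_eq hg, hK, Subgroup.map_bot]

/-- Two letters are sent to the generators and all others to `1`; in a finite group the
submonoid generated by a set is already the subgroup. -/
theorem exists_surjective_of_isTwoGenerated {A G : Type*} [Nontrivial A] [Group G] [Finite G]
    (hG : IsTwoGenerated G) : ∃ η : FreeMonoid A →* G, Function.Surjective η := by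
  classical
  obtain ⟨x, y, hxy⟩ := hG
  obtain ⟨a, b, hab⟩ := exists_pair_ne A
  let η : FreeMonoid A →* G := FreeMonoid.lift fun c => if c = a then x else if c = b then y else 1
  refine ⟨η, ?_⟩
  rw [← MonoidHom.mrange_eq_top, ← top_le_iff, ← Subgroup.top_toSubmonoid, ← hxy,
    Subgroup.closure_toSubmonoid_of_finite, Submonoid.closure_le]
  rintro _ (rfl | rfl)
  · exact ⟨FreeMonoid.of a, by simp [η]⟩
  · exact ⟨FreeMonoid.of b, by simp [η, hab.symm]⟩

/-! ### Dihedral groups -/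

namespace DihedralGroup

open scoped commutatorElement

theorem isTwoGenerated (m : ℕ) : IsTwoGenerated (DihedralGroup m) := by
  refine ⟨r 1, sr 0, eq_top_iff.mpr fun g _ => ?_⟩
  have hr (i : ZMod m) : r i ∈ Subgroup.closure {r 1, sr (0 : ZMod m)} := by
    obtain ⟨k, rfl⟩ := ZMod.intCast_surjective i
    rw [← r_one_zpow]
    exact zpow_mem (Subgroup.subset_closure (by simp)) k
  cases g with
  | r i => exact hr i
  | sr i =>
    have : sr i = sr 0 * r i := by simp
    rw [this]
    exact mul_mem (Subgroup.subset_closure (by simp)) (hr i)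

theorem r_two_pow_mem_lowerCentralSeries (m k : ℕ) :
    r ((2 : ZMod m) ^ k) ∈ (⊤ : Subgroup (DihedralGroup m)).lowerCentralSeries k := by
  induction k with
  | zero => simp
  | succ k ih =>
    rw [Subgroup.lowerCentralSeries_succ]
    have : r ((2 : ZMod m) ^ (k + 1)) = ⁅r ((2 : ZMod m) ^ k), sr 0⁆ := by
      simp [commutatorElement_def, pow_succ, mul_two]
    rw [this]
    exact Subgroup.commutator_mem_commutator ih (Subgroup.mem_top _)

/-- All commutators are rotations `r (2 * i)`, and commuting the rotation `r i` with a reflection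
gives `r (2 * i)`. The bound fails for the term of index `0`, which contains the reflections. -/
theorem lowerCentralSeries_succ_le_zpowers (m k : ℕ) :
    (⊤ : Subgroup (DihedralGroup m)).lowerCentralSeries (k + 1) ≤
      Subgroup.zpowers (r ((2 : ZMod m) ^ (k + 1))) := by
  have hmem (j : ZMod m) (k : ℕ) (h : (2 : ZMod m) ^ k ∣ j) :
      r j ∈ Subgroup.zpowers (r ((2 : ZMod m) ^ k)) := by
    obtain ⟨i, rfl⟩ := h
    obtain ⟨c, rfl⟩ := ZMod.intCast_surjective i
    exact ⟨c, by simp⟩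
  induction k with
  | zero =>
    rw [Subgroup.lowerCentralSeries_succ, Subgroup.commutator_le]
    rintro (i | i) - (j | j) - <;> simp only [commutatorElement_def, r_mul_r, r_mul_sr, sr_mul_r,
      sr_mul_sr, inv_r, inv_sr] <;> apply hmem
    · exact ⟨0, by ring⟩
    · exact ⟨i, by ring⟩
    · exact ⟨-j, by ring⟩
    · exact ⟨j - i, by ring⟩
  | succ k ih =>
    rw [Subgroup.lowerCentralSeries_succ, Subgroup.commutator_le]
    intro g hg h _
    obtain ⟨c, rfl⟩ := ih hg
    rcases h with j | j <;> simp only [commutatorElement_def, r_zpow, r_mul_r, r_mul_sr, sr_mul_r,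
      sr_mul_sr, inv_r, inv_sr] <;> apply hmem
    · exact ⟨0, by ring⟩
    · exact ⟨c, by ring⟩

theorem lowerCentralSeries_two_pow_eq_bot (n : ℕ) :
    (⊤ : Subgroup (DihedralGroup (2 ^ (n + 1)))).lowerCentralSeries (n + 1) = ⊥ := by
  have h0 : (2 : ZMod (2 ^ (n + 1))) ^ (n + 1) = 0 := by
    exact_mod_cast ZMod.natCast_self (2 ^ (n + 1))
  have := lowerCentralSeries_succ_le_zpowers (2 ^ (n + 1)) n
  rwa [h0, r_zero, Subgroup.zpowers_one_eq_bot, le_bot_iff] at this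

instance isNilpotent_two_pow (n : ℕ) : Group.IsNilpotent (DihedralGroup (2 ^ (n + 1))) :=
  Subgroup.nilpotent_iff_lowerCentralSeries.mpr ⟨n + 1, lowerCentralSeries_two_pow_eq_bot n⟩

theorem nilpotencyClass_two_pow (n : ℕ) :
    Group.nilpotencyClass (DihedralGroup (2 ^ (n + 1))) = n + 1 := by
  refine le_antisymm ?_ ?_
  · exact Subgroup.lowerCentralSeries_eq_bot_iff_nilpotencyClass_le.mp
      (lowerCentralSeries_two_pow_eq_bot n)
  · by_contra! h
    have h1 := r_two_pow_mem_lowerCentralSeries (2 ^ (n + 1)) n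
    rw [Subgroup.lowerCentralSeries_eq_bot_iff_nilpotencyClass_le.mpr (Nat.le_of_lt_succ h),
      Subgroup.mem_bot, one_def, r.injEq] at h1
    have h2 : ((2 ^ n : ℕ) : ZMod (2 ^ (n + 1))) = 0 := by exact_mod_cast h1
    rw [ZMod.natCast_eq_zero_iff, Nat.pow_dvd_pow_iff_le_right (by norm_num)] at h2
    omega

end DihedralGroup

/-! ### Solvable two-generated groups of prescribed derived length -/

open scoped MatrixGroups commutatorElement

theorem isTwoGenerated_of_surjective {G H : Type*} [Group G] [Group H] (f : G →* H)
    (hf : Function.Surjective f) (hG : IsTwoGenerated G) : IsTwoGenerated H := by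
  obtain ⟨x, y, hxy⟩ := hG
  refine ⟨f x, f y, ?_⟩
  rw [← Set.image_pair, ← MonoidHom.map_closure, hxy, Subgroup.map_top_of_surjective f hf]

theorem isTwoGenerated_freeGroup_bool : IsTwoGenerated (FreeGroup Bool) := by
  refine ⟨FreeGroup.of true, FreeGroup.of false, ?_⟩
  rw [← FreeGroup.closure_range_of]
  congr 1
  ext x
  simp [or_comm]

/-- The homomorphism from the free group of rank two to `SL(2, ℤ)` whose values on the free
generators are the transvections `[1, 2; 0, 1]` and `[1, 0; 2, 1]`, both trivial modulo `2`. -/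
def toSL2Int : FreeGroup Bool →* SL(2, ℤ) :=
  FreeGroup.lift fun b => if b then ⟨!![1, 2; 0, 1], by simp⟩ else ⟨!![1, 0; 2, 1], by simp⟩

/-- The composition of `toSL2Int` with reduction modulo `m`. -/
def toSL2Mod (m : ℕ) : FreeGroup Bool →* SL(2, ZMod m) :=
  (Matrix.SpecialLinearGroup.map (Int.castRingHom (ZMod m))).comp toSL2Int

theorem toSL2Mod_two : toSL2Mod 2 = 1 := by
  ext1 b
  cases b <;> simp only [toSL2Mod, toSL2Int] <;> ext i j <;>
    fin_cases i <;> fin_cases j <;> simp <;> rfl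

theorem toSL2Mod_apply (m : ℕ) (x : FreeGroup Bool) (i j : Fin 2) :
    toSL2Mod m x i j = ((toSL2Int x i j : ℤ) : ZMod m) := by
  simp [toSL2Mod]

theorem toSL2Mod_eq_one_iff {m : ℕ} {x : FreeGroup Bool} :
    toSL2Mod m x = 1 ↔
      ∀ i j, (m : ℤ) ∣ toSL2Int x i j - (1 : Matrix (Fin 2) (Fin 2) ℤ) i j := by
  rw [Matrix.SpecialLinearGroup.ext_iff]
  refine forall_congr' fun i => forall_congr' fun j => ?_
  rw [toSL2Mod_apply, ← ZMod.intCast_zmod_eq_zero_iff_dvd, Int.cast_sub, sub_eq_zero]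
  fin_cases i <;> fin_cases j <;> simp

/-- If `x` and `y` are both congruent to `1` modulo an even number `m`, they commute
modulo `2 * m`: the products `x * y` and `y * x` differ by a multiple of `m ^ 2`. -/
theorem toSL2Mod_two_mul_mul_comm {m : ℕ} (hm : 2 ∣ m) {x y : FreeGroup Bool}
    (hx : toSL2Mod m x = 1) (hy : toSL2Mod m y = 1) :
    toSL2Mod (2 * m) x * toSL2Mod (2 * m) y = toSL2Mod (2 * m) y * toSL2Mod (2 * m) x := by
  have key (x : FreeGroup Bool) (hx : toSL2Mod m x = 1) : ∃ X : Fin 2 → Fin 2 → ZMod (2 * m),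
      ∀ i j, toSL2Mod (2 * m) x i j = (1 : Matrix (Fin 2) (Fin 2) ℤ) i j + m * X i j := by
    choose X hX using toSL2Mod_eq_one_iff.mp hx
    refine ⟨fun i j => X i j, fun i j => ?_⟩
    rw [toSL2Mod_apply, sub_eq_iff_eq_add'.mp (hX i j)]
    push_cast
    rfl
  obtain ⟨X, hX⟩ := key x hx
  obtain ⟨Y, hY⟩ := key y hy
  have h0 : (m : ZMod (2 * m)) * m = 0 := by
    obtain ⟨k, hk⟩ := hm
    have : ((m * m : ℕ) : ZMod (2 * m)) = 0 := by
      rw [ZMod.natCast_eq_zero_iff]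
      exact ⟨k, by nth_rewrite 1 [hk]; ring⟩
    exact_mod_cast this
  ext i j
  simp only [Matrix.SpecialLinearGroup.coe_mul, Matrix.mul_apply, Fin.sum_univ_two, hX, hY,
    Matrix.one_apply]
  fin_cases i <;> fin_cases j <;> simp
  · linear_combination (X 0 1 * Y 1 0 - Y 0 1 * X 1 0) * h0
  · linear_combination (X 0 0 * Y 0 1 + X 0 1 * Y 1 1 - Y 0 0 * X 0 1 - Y 0 1 * X 1 1) * h0
  · linear_combination (X 1 0 * Y 0 0 + X 1 1 * Y 1 0 - Y 1 0 * X 0 0 - Y 1 1 * X 1 0) * h0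
  · linear_combination (X 1 0 * Y 0 1 - Y 1 0 * X 0 1) * h0

theorem derivedSeries_le_ker_toSL2Mod (k : ℕ) :
    derivedSeries (FreeGroup Bool) k ≤ (toSL2Mod (2 ^ (k + 1))).ker := by
  induction k with
  | zero => simp [toSL2Mod_two]
  | succ k ih =>
    rw [derivedSeries_succ, Subgroup.commutator_le]
    intro x hx y hy
    rw [MonoidHom.mem_ker, map_commutatorElement, commutatorElement_eq_one_iff_mul_comm]
    rw [pow_succ' 2 (k + 1)]
    exact toSL2Mod_two_mul_mul_comm (dvd_pow_self 2 k.succ_ne_zero) (ih hx) (ih hy)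

/-- The images of the two free generators in `SL(2, ZMod 5)` are commutators of elements of the
subgroup that they generate, so they survive in every term of the derived series. -/
theorem toSL2Mod_five_of_mem_map_derivedSeries (n : ℕ) (b : Bool) :
    toSL2Mod 5 (FreeGroup.of b) ∈ (derivedSeries (FreeGroup Bool) n).map (toSL2Mod 5) := by
  set t := toSL2Mod 5 (FreeGroup.of true) with ht
  set u := toSL2Mod 5 (FreeGroup.of false) with hu
  have ht' : t = ⟨!![1, 2; 0, 1], by simp⟩ := by
    ext i j
    rw [ht, toSL2Mod_apply]
    fin_cases i <;> fin_cases j <;> simp [toSL2Int]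
  have hu' : u = ⟨!![1, 0; 2, 1], by simp⟩ := by
    ext i j
    rw [hu, toSL2Mod_apply]
    fin_cases i <;> fin_cases j <;> simp [toSL2Int]
  -- `d` is the diagonal matrix with entries `2` and `3`; conjugation by it multiplies the
  -- off-diagonal entries by `4` and its commutator with a transvection multiplies them by `3`.
  let d := t * u * t ^ 3 * u ^ 3 * t ^ 2
  have hdt : ⁅d, t ^ 2⁆ = t := by
    rw [commutatorElement_def, mul_inv_eq_iff_eq_mul, mul_inv_eq_iff_eq_mul]
    simp only [d, ht', hu']
    decide
  have hdu : ⁅d, u ^ 2⁆ = u := by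
    rw [commutatorElement_def, mul_inv_eq_iff_eq_mul, mul_inv_eq_iff_eq_mul]
    simp only [d, ht', hu']
    decide
  have key : t ∈ (derivedSeries (FreeGroup Bool) n).map (toSL2Mod 5) ∧
      u ∈ (derivedSeries (FreeGroup Bool) n).map (toSL2Mod 5) := by
    induction n with
    | zero => exact ⟨⟨_, Subgroup.mem_top _, rfl⟩, ⟨_, Subgroup.mem_top _, rfl⟩⟩
    | succ n ih =>
      obtain ⟨iht, ihu⟩ := ih
      have hd : d ∈ (derivedSeries (FreeGroup Bool) n).map (toSL2Mod 5) :=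
        mul_mem (mul_mem (mul_mem (mul_mem iht ihu) (pow_mem iht 3)) (pow_mem ihu 3))
          (pow_mem iht 2)
      rw [derivedSeries_succ, Subgroup.map_commutator]
      have h1 := Subgroup.commutator_mem_commutator hd (pow_mem iht 2)
      have h2 := Subgroup.commutator_mem_commutator hd (pow_mem ihu 2)
      rw [hdt] at h1
      rw [hdu] at h2
      exact ⟨h1, h2⟩
  cases b
  exacts [key.2, key.1]

/-- Some element of the `n`-th term of the derived series has a nontrivial image in `SL(2, ℤ)`,
and any power of `2` exceeding the entries of this image minus `1` separates it from `1`. -/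
theorem exists_not_derivedSeries_le_ker_toSL2Mod (n : ℕ) :
    ∃ k, ¬ derivedSeries (FreeGroup Bool) n ≤ (toSL2Mod (2 ^ (k + 1))).ker := by
  by_contra! h
  obtain ⟨x, hx, hxt⟩ := toSL2Mod_five_of_mem_map_derivedSeries n true
  have hx1 : toSL2Mod 5 x = 1 := by
    refine toSL2Mod_eq_one_iff.mpr fun i j => ?_
    have h0 : toSL2Int x i j - (1 : Matrix (Fin 2) (Fin 2) ℤ) i j = 0 := by
      set z := toSL2Int x i j - (1 : Matrix (Fin 2) (Fin 2) ℤ) i j with hz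
      have hdvd : ((2 ^ (z.natAbs + 1) : ℕ) : ℤ) ∣ z := toSL2Mod_eq_one_iff.mp (h z.natAbs hx) i j
      refine Int.eq_zero_of_dvd_of_natAbs_lt_natAbs hdvd ?_
      rw [Int.natAbs_natCast]
      exact Nat.lt_of_succ_lt Nat.lt_two_pow_self
    rw [h0]
    exact dvd_zero _
  rw [hx1] at hxt
  have := congrArg (fun M : SL(2, ZMod 5) => M 0 1) hxt
  rw [toSL2Mod_apply] at this
  revert this
  simp [toSL2Int]
  decide

theorem exists_isTwoGenerated_derivedLength_eq (n : ℕ) :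
    ∃ (G : Type) (_ : Group G), Finite G ∧ IsTwoGenerated G ∧ Group.IsSolvable G ∧
      derivedLength G = n + 1 := by
  obtain ⟨k, hk⟩ := exists_not_derivedSeries_le_ker_toSL2Mod n
  let φ := (toSL2Mod (2 ^ (k + 1))).rangeRestrict
  have hφ : Function.Surjective φ := MonoidHom.rangeRestrict_surjective _
  have hker : φ.ker = (toSL2Mod (2 ^ (k + 1))).ker := MonoidHom.ker_rangeRestrict _
  let Q := (toSL2Mod (2 ^ (k + 1))).range
  have hQk : derivedSeries Q k = ⊥ := by
    rw [← map_derivedSeries_eq hφ, Subgroup.map_eq_bot_iff, hker]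
    exact derivedSeries_le_ker_toSL2Mod k
  have hQn : derivedSeries Q n ≠ ⊥ := by
    rwa [← map_derivedSeries_eq hφ, Ne, Subgroup.map_eq_bot_iff, hker]
  have : Group.IsSolvable Q := ⟨⟨k, hQk⟩⟩
  let π := QuotientGroup.mk' (derivedSeries Q (n + 1))
  have hπ : Function.Surjective π := QuotientGroup.mk'_surjective _
  have hsol : Group.IsSolvable (Q ⧸ derivedSeries Q (n + 1)) := inferInstance
  refine ⟨Q ⧸ derivedSeries Q (n + 1), inferInstance, inferInstance,
    isTwoGenerated_of_surjective (π.comp φ) (hπ.comp hφ) isTwoGenerated_freeGroup_bool,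
    hsol, le_antisymm ?_ ?_⟩
  · rw [derivedLength_le_iff, ← map_derivedSeries_eq hπ, Subgroup.map_eq_bot_iff,
      QuotientGroup.ker_mk']
  · by_contra! h
    have h := Nat.le_of_lt_succ h
    rw [derivedLength_le_iff, ← map_derivedSeries_eq hπ, Subgroup.map_eq_bot_iff,
      QuotientGroup.ker_mk'] at h
    -- In a solvable group the derived series decreases strictly until it reaches `⊥`.
    exact (Group.IsSolvable.commutator_lt_of_ne_bot hQn).not_ge h

/-! ### Strictness of the hierarchies -/

theorem Gnil_mono (A : Type*) : Monotone (Gnil A) := by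
  rintro m n hmn L ⟨G, hG, hfin, hnil, hc, hL⟩
  exact ⟨G, hG, hfin, hnil, hc.trans hmn, hL⟩

theorem Gsol_mono (A : Type*) : Monotone (Gsol A) := by
  rintro m n hmn L ⟨G, hG, hfin, hsol, hc, hL⟩
  exact ⟨G, hG, hfin, hsol, hc.trans hmn, hL⟩

theorem proposition1 {A : Type*} [Finite A] (hA : 2 ≤ Nat.card A) (n : ℕ) (hn : 1 ≤ n) :
    -- the two hierarchies are strict
    (Gnil A n ⊂ Gnil A (n + 1) ∧ Gsol A n ⊂ Gsol A (n + 1)) ∧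
    -- a witness in the nilpotent case: the dihedral group of order `2 ^ (n + 2)`
    (IsTwoGenerated (DihedralGroup (2 ^ (n + 1))) ∧
      Group.IsNilpotent (DihedralGroup (2 ^ (n + 1))) ∧
      Group.nilpotencyClass (DihedralGroup (2 ^ (n + 1))) = n + 1 ∧
      ∃ η : FreeMonoid A →* DihedralGroup (2 ^ (n + 1)), Function.Surjective η ∧
        wordProblem η ∈ Gnil A (n + 1) \ Gnil A n) ∧
    -- a witness in the solvable case
    (∃ (G : Type) (_ : Group G), Finite G ∧ IsTwoGenerated G ∧ Group.IsSolvable G ∧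
      derivedLength G = n + 1 ∧
      ∃ η : FreeMonoid A →* G, Function.Surjective η ∧
        wordProblem η ∈ Gsol A (n + 1) \ Gsol A n) := by
  have hAn : Nontrivial A := Finite.one_lt_card_iff_nontrivial.mp hA
  have htwo := DihedralGroup.isTwoGenerated (2 ^ (n + 1))
  have hclass := DihedralGroup.nilpotencyClass_two_pow n
  obtain ⟨η, hη⟩ := exists_surjective_of_isTwoGenerated (A := A) htwo
  have hmemN : wordProblem η ∈ Gnil A (n + 1) \ Gnil A n :=
    ⟨⟨_, _, inferInstance, inferInstance, hclass.le, wordProblem_recognises η⟩,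
      fun h => by have := nilpotencyClass_le_of_wordProblem_mem_Gnil hη h; omega⟩
  obtain ⟨G, _, hfin, hG, hsol, hlen⟩ := exists_isTwoGenerated_derivedLength_eq n
  obtain ⟨θ, hθ⟩ := exists_surjective_of_isTwoGenerated (A := A) hG
  have hmemS : wordProblem θ ∈ Gsol A (n + 1) \ Gsol A n :=
    ⟨⟨G, _, hfin, hsol, hlen.le, wordProblem_recognises θ⟩,
      fun h => by have := derivedLength_le_of_wordProblem_mem_Gsol hθ h; omega⟩
  exact ⟨⟨(Set.ssubset_iff_of_subset (Gnil_mono A n.le_succ)).mpr ⟨_, hmemN⟩,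
      (Set.ssubset_iff_of_subset (Gsol_mono A n.le_succ)).mpr ⟨_, hmemS⟩⟩,
    ⟨htwo, inferInstance, hclass, η, hη, hmemN⟩,
    ⟨G, _, hfin, hG, hsol, hlen, θ, hθ, hmemS⟩⟩
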